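/- A \emph{$\dagger$-category} is a category $\mathbf H$ with a functor $\dagger:\mathbf H^{\mathrm{op}}\to\mathbf H$ satisfying $X^\dagger=X$ on objects and $f^{\dagger\dagger}=f$ on morphisms. A morphism $m$ is a \emph{$\dagger$-mono} if $m^\dagger m=\mathrm{id}$, a \emph{$\dagger$-epi} if $mm^\dagger=\mathrm{id}$, and a \emph{$\dagger$-iso} if it is both; a biproduct is a \emph{$\dagger$-biproduct} if each injection is the dagger of the corresponding projection; a \emph{$\dagger$-equaliser} (\emph{$\dagger$-kernel}) is an equaliser (kernel) that is a $\dagger$-mono. A \emph{pre-Hilbert category} is a $\dagger$-category that has finite $\dagger$-biproducts (including a zero object) and $\dagger$-equalisers, in which every $\dagger$-mono is a $\dagger$-kernel, and which carries a symmetric monoidal structure $(\otimes,C)$ with $(f\otimes g)^\dagger=f^\dagger\otimes g^\dagger$ whose coherence isomorphisms are $\dagger$-isos. For an object $X$ of a pre-Hilbert category $\mathbf H$, let $\mathrm{ClSub}(X)$ be the partially ordered class of those subobjects of $X$ that can be represented by a $\dagger$-mono. Every morphism factors as an epi followed by a $\dagger$-mono, and the latter, which is unique as a subobject, is its image $\mathrm{Im}$.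 For $f:X\to Y$ let $\exists_f:\mathrm{ClSub}(X)\to\mathrm{ClSub}(Y)$ be the monotone map $\exists_f(m)=\mathrm{Im}(fm)$; let $\perp_X:\mathrm{ClSub}(X)^{\mathrm{op}}\to\mathrm{ClSub}(X)$ be $m^\perp=\ker(m^\dagger)$; and put $$f^\perp=\perp_Y\circ(\exists_f)^{\mathrm{op}}:\mathrm{ClSub}(X)^{\mathrm{op}}\to\mathrm{ClSub}(Y).$$ A \emph{scalar} is a morphism $s:C\to C$, and for $f:X\to Y$ the morphism $s\bullet f:X\to Y$ is the composite $X\cong C\otimes X\xrightarrow{s\otimes f}C\otimes Y\cong Y$. \textbf{Theorem.} Let $\mathbf H$ be a pre-Hilbert category whose monoidal unit $C$ is simple, i.e. $\mathrm{Sub}(C)=\{0,C\}$, and a generator, i.e. two morphisms $h,k:X\to Y$ are equal as soon as $hx=kx$ for all $x:C\to X$. Let $f:X\to Y$ and $g:Y\to X$ be morphisms of $\mathbf H$ such that $(f^\perp)^{\mathrm{op}}:\mathrm{ClSub}(X)\to\mathrm{ClSub}(Y)^{\mathrm{op}}$ is left adjoint to $g^\perp:\mathrm{ClSub}(Y)^{\mathrm{op}}\to\mathrm{ClSub}(X)$.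 Then there is a scalar $s:C\to C$ with $g=s\bullet f^\dagger$; and if $f\neq 0$, this $s$ is unique. -/

import Mathlib

open CategoryTheory CategoryTheory.Limits MonoidalCategory
open scoped ZeroObject

universe v u

/-- A `†`-category: an involutive, identity-on-objects functor `Hᵒᵖ ⥤ H`,
given by its action on morphisms. -/
class DaggerCategory (H : Type u) [Category.{v} H] where
  /-- The dagger of a morphism. -/
  dagger : ∀ {X Y : H}, (X ⟶ Y) → (Y ⟶ X)
  dagger_id : ∀ X : H, dagger (𝟙 X) = 𝟙 X
  dagger_comp : ∀ {X Y Z : H} (f : X ⟶ Y) (g : Y ⟶ Z), dagger (f ≫ g) = dagger g ≫ dagger f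
  dagger_dagger : ∀ {X Y : H} (f : X ⟶ Y), dagger (dagger f) = f

namespace PreHilb

open DaggerCategory

/-- A `†`-mono is a morphism `m` with `m† ∘ m = id`. -/
def IsDaggerMono {H : Type u} [Category.{v} H] [DaggerCategory H] {X Y : H} (m : X ⟶ Y) : Prop :=
  m ≫ dagger m = 𝟙 X

/-- A `†`-epi is a morphism `e` with `e ∘ e† = id`. -/
def IsDaggerEpi {H : Type u} [Category.{v} H] [DaggerCategory H] {X Y : H} (e : X ⟶ Y) : Prop :=
  dagger e ≫ e = 𝟙 Y

/-- A `†`-iso is a morphism that is both `†`-mono and `†`-epi. -/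
def IsDaggerIso {H : Type u} [Category.{v} H] [DaggerCategory H] {X Y : H} (f : X ⟶ Y) : Prop :=
  IsDaggerMono f ∧ IsDaggerEpi f

/-- The symmetric monoidal structure cooperates with the dagger: `(f ⊗ g)† = f† ⊗ g†`, and the
coherence isomorphisms are `†`-isos. -/
class SymmetricDaggerMonoidal (H : Type u) [Category.{v} H] [DaggerCategory H]
    [MonoidalCategory H] [SymmetricCategory H] : Prop where
  dagger_tensorHom : ∀ {X₁ Y₁ X₂ Y₂ : H} (f : X₁ ⟶ Y₁) (g : X₂ ⟶ Y₂),
    dagger (f ⊗ₘ g) = dagger f ⊗ₘ dagger g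
  associator_isDaggerIso : ∀ X Y Z : H, IsDaggerIso (α_ X Y Z).hom
  leftUnitor_isDaggerIso : ∀ X : H, IsDaggerIso (λ_ X).hom
  rightUnitor_isDaggerIso : ∀ X : H, IsDaggerIso (ρ_ X).hom
  braiding_isDaggerIso : ∀ X Y : H, IsDaggerIso (β_ X Y).hom

end PreHilb

open DaggerCategory PreHilb in
/-- A pre-Hilbert category: a `†`-category with finite `†`-biproducts (a zero object and binary
`†`-biproducts) and `†`-equalisers, in which every `†`-mono is a `†`-kernel, and which is symmetric
`†`-monoidal. The zero morphisms are unique once they exist, so they carry no extra structure. -/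
class PreHilbertCategory (H : Type u) [Category.{v} H] [HasZeroMorphisms H] [DaggerCategory H]
    [MonoidalCategory H] [SymmetricCategory H] : Prop
    extends HasZeroObject H, SymmetricDaggerMonoidal H where
  exists_daggerBiproduct : ∀ X Y : H, ∃ b : BinaryBicone X Y, Nonempty b.IsBilimit ∧
    dagger b.fst = b.inl ∧ dagger b.snd = b.inr
  exists_daggerEqualizer : ∀ {X Y : H} (f g : X ⟶ Y), ∃ (E : H) (e : E ⟶ X)
    (w : e ≫ f = e ≫ g), IsDaggerMono e ∧ Nonempty (IsLimit (Fork.ofι e w))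
  isKernel_of_isDaggerMono : ∀ {M X : H} (m : M ⟶ X), IsDaggerMono m →
    ∃ (Z : H) (f : X ⟶ Z) (w : m ≫ f = 0), Nonempty (IsLimit (KernelFork.ofι m w))

namespace PreHilb

open DaggerCategory PreHilbertCategory

section Dagger

variable {H : Type u} [Category.{v} H] [DaggerCategory H]

theorem IsDaggerMono.mono {X Y : H} {m : X ⟶ Y} (h : IsDaggerMono m) : Mono m :=
  ⟨fun a b w => by
    have h' : m ≫ dagger m = 𝟙 X := h
    have := congrArg (· ≫ dagger m) w
    simpa [h'] using this⟩

theorem IsDaggerMono.comp {X Y Z : H} {m : X ⟶ Y} {n : Y ⟶ Z} (hm : IsDaggerMono m)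
    (hn : IsDaggerMono n) : IsDaggerMono (m ≫ n) := by
  have hm' : m ≫ dagger m = 𝟙 X := hm
  have hn' : n ≫ dagger n = 𝟙 Y := hn
  have : n ≫ dagger n ≫ dagger m = dagger m := by rw [← Category.assoc, hn', Category.id_comp]
  simp [IsDaggerMono, dagger_comp, this, hm']

/-- The `†`-subobjects of `X`: the subobjects that can be represented by a `†`-mono, ordered as
subobjects. -/
def ClSub (X : H) : Type max u v :=
  {S : Subobject X // ∃ (M : H) (m : M ⟶ X) (_ : Mono m), IsDaggerMono m ∧ Subobject.mk m = S}

instance (X : H) : PartialOrder (ClSub X) :=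
  inferInstanceAs (PartialOrder {S : Subobject X //
    ∃ (M : H) (m : M ⟶ X) (_ : Mono m), IsDaggerMono m ∧ Subobject.mk m = S})

namespace ClSub

/-- The `†`-subobject represented by a `†`-mono. -/
noncomputable def mk {M X : H} (m : M ⟶ X) (hm : IsDaggerMono m) : ClSub X :=
  ⟨@Subobject.mk _ _ _ _ m hm.mono, M, m, hm.mono, hm, rfl⟩

theorem exists_rep {X : H} (S : ClSub X) :
    ∃ (M : H) (m : M ⟶ X) (hm : IsDaggerMono m), mk m hm = S := by
  obtain ⟨S, M, m, _, hm, rfl⟩ := S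
  exact ⟨M, m, hm, rfl⟩

/-- The domain of a chosen `†`-mono representing a `†`-subobject. -/
noncomputable def dom {X : H} (S : ClSub X) : H := S.exists_rep.choose

/-- A chosen `†`-mono representing a `†`-subobject. -/
noncomputable def incl {X : H} (S : ClSub X) : S.dom ⟶ X := S.exists_rep.choose_spec.choose

theorem incl_isDaggerMono {X : H} (S : ClSub X) : IsDaggerMono S.incl :=
  S.exists_rep.choose_spec.choose_spec.choose

theorem mk_incl {X : H} (S : ClSub X) : mk S.incl S.incl_isDaggerMono = S :=
  S.exists_rep.choose_spec.choose_spec.choose_spec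

theorem mk_le_mk {X M N : H} {m : M ⟶ X} {n : N ⟶ X} (hm : IsDaggerMono m)
    (hn : IsDaggerMono n) : mk m hm ≤ mk n hn ↔ ∃ i : M ⟶ N, i ≫ n = m := by
  have := hm.mono
  have := hn.mono
  constructor
  · intro h
    exact ⟨Subobject.ofMkLEMk m n h, Subobject.ofMkLEMk_comp h⟩
  · rintro ⟨i, hi⟩
    exact Subobject.mk_le_mk_of_comm i hi

theorem le_iff {X : H} (S T : ClSub X) : S ≤ T ↔ ∃ i : S.dom ⟶ T.dom, i ≫ T.incl = S.incl := by
  rw [← mk_le_mk S.incl_isDaggerMono T.incl_isDaggerMono, mk_incl, mk_incl]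

end ClSub

end Dagger

section PreHilbert

variable {H : Type u} [Category.{v} H] [HasZeroMorphisms H] [DaggerCategory H]
  [MonoidalCategory H] [SymmetricCategory H] [PreHilbertCategory H]

theorem dagger_zero (X Y : H) : dagger (0 : X ⟶ Y) = 0 := by
  have h : (0 : X ⟶ Y) = (0 : X ⟶ 0) ≫ (0 : (0 : H) ⟶ Y) := by simp
  rw [h, dagger_comp]
  have : dagger (0 : (0 : H) ⟶ Y) = 0 := HasZeroObject.to_zero_ext _ _
  rw [this, zero_comp]

theorem exists_daggerKernel {X Y : H} (f : X ⟶ Y) :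
    ∃ (K : H) (k : K ⟶ X), IsDaggerMono k ∧ ∃ w : k ≫ f = 0,
      Nonempty (IsLimit (KernelFork.ofι k w)) := by
  obtain ⟨K, k, w, hk, ⟨hl⟩⟩ := exists_daggerEqualizer f 0
  have w' : k ≫ f = 0 := by rw [w, comp_zero]
  exact ⟨K, k, hk, w', ⟨hl⟩⟩

/-- The domain of `ker f`. -/
noncomputable def kerObj {X Y : H} (f : X ⟶ Y) : H := (exists_daggerKernel f).choose

/-- The `†`-kernel `ker f` of a morphism. -/
noncomputable def ker {X Y : H} (f : X ⟶ Y) : kerObj f ⟶ X :=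
  (exists_daggerKernel f).choose_spec.choose

theorem ker_isDaggerMono {X Y : H} (f : X ⟶ Y) : IsDaggerMono (ker f) :=
  (exists_daggerKernel f).choose_spec.choose_spec.1

theorem ker_comp {X Y : H} (f : X ⟶ Y) : ker f ≫ f = 0 :=
  (exists_daggerKernel f).choose_spec.choose_spec.2.choose

theorem ker_isLimit {X Y : H} (f : X ⟶ Y) :
    Nonempty (IsLimit (KernelFork.ofι (ker f) (ker_comp f))) :=
  (exists_daggerKernel f).choose_spec.choose_spec.2.choose_spec

theorem ker_lift {X Y Z : H} (f : X ⟶ Y) (a : Z ⟶ X) (h : a ≫ f = 0) :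
    ∃ l : Z ⟶ kerObj f, l ≫ ker f = a :=
  ⟨_, (KernelFork.IsLimit.lift' (ker_isLimit f).some a h).2⟩

theorem exists_factorisation {X Y : H} (f : X ⟶ Y) :
    ∃ (I : H) (e : X ⟶ I) (m : I ⟶ Y), Epi e ∧ IsDaggerMono m ∧ e ≫ m = f := by
  -- `m` is the kernel of the cokernel `c` of `f`
  have hc : f ≫ dagger (ker (dagger f)) = 0 := by
    have := congrArg dagger (ker_comp (dagger f))
    rwa [dagger_comp, dagger_dagger, dagger_zero] at this
  have hm := ker_isDaggerMono (dagger (ker (dagger f)))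
  have hmc := ker_comp (dagger (ker (dagger f)))
  obtain ⟨e, he⟩ := ker_lift _ f hc
  generalize ker (dagger (ker (dagger f))) = m at *
  refine ⟨_, e, m, ⟨fun {Z} a b hab => ?_⟩, hm, he⟩
  obtain ⟨J, j, w, hj, ⟨hl⟩⟩ := exists_daggerEqualizer a b
  obtain ⟨e', he'⟩ := Fork.IsLimit.lift' hl e hab
  obtain ⟨W, h, wh, ⟨hk⟩⟩ := isKernel_of_isDaggerMono (j ≫ m) (hj.comp hm)
  have hfh : f ≫ h = 0 := by
    rw [← he, ← he']
    simp only [Fork.ι_ofι, Category.assoc] at wh ⊢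
    rw [wh, comp_zero]
  obtain ⟨t, ht⟩ := ker_lift (dagger f) (dagger h) (by rw [← dagger_comp, hfh, dagger_zero])
  have ht' : dagger (ker (dagger f)) ≫ dagger t = h := by
    rw [← dagger_comp, ht, dagger_dagger]
  have hmh : m ≫ h = 0 := by rw [← ht', ← Category.assoc, hmc, zero_comp]
  obtain ⟨l, hl'⟩ := KernelFork.IsLimit.lift' hk m hmh
  have := hm.mono
  have hlj : l ≫ j = 𝟙 _ := by
    rw [← cancel_mono m]
    simpa using hl'
  calc a = l ≫ j ≫ a := by rw [← Category.assoc, hlj, Category.id_comp]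
    _ = b := by rw [w, ← Category.assoc, hlj, Category.id_comp]

theorem factorisation_le {X Y I N : H} {e : X ⟶ I} {m : I ⟶ Y} {a : X ⟶ N} {n : N ⟶ Y}
    (he : Epi e) (hn : IsDaggerMono n) (h : e ≫ m = a ≫ n) : ∃ i : I ⟶ N, i ≫ n = m := by
  obtain ⟨W, c, w, ⟨hk⟩⟩ := isKernel_of_isDaggerMono n hn
  have hmc : m ≫ c = 0 := by
    rw [← cancel_epi e, ← Category.assoc, h, Category.assoc, w, comp_zero, comp_zero]
  exact ⟨_, (KernelFork.IsLimit.lift' hk m hmc).2⟩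

/-- The domain of the image of a morphism. -/
noncomputable def imObj {X Y : H} (f : X ⟶ Y) : H := (exists_factorisation f).choose

/-- The epi part of the factorisation of `f` as an epi followed by a `†`-mono. -/
noncomputable def coim {X Y : H} (f : X ⟶ Y) : X ⟶ imObj f :=
  (exists_factorisation f).choose_spec.choose

/-- The (direct) image of `f`: the `†`-mono part of the factorisation of `f` as an epi followed by
a `†`-mono. -/
noncomputable def im {X Y : H} (f : X ⟶ Y) : imObj f ⟶ Y :=
  (exists_factorisation f).choose_spec.choose_spec.choose

theorem coim_epi {X Y : H} (f : X ⟶ Y) : Epi (coim f) :=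
  (exists_factorisation f).choose_spec.choose_spec.choose_spec.1

theorem im_isDaggerMono {X Y : H} (f : X ⟶ Y) : IsDaggerMono (im f) :=
  (exists_factorisation f).choose_spec.choose_spec.choose_spec.2.1

theorem coim_im {X Y : H} (f : X ⟶ Y) : coim f ≫ im f = f :=
  (exists_factorisation f).choose_spec.choose_spec.choose_spec.2.2

/-- The orthocomplement `m^⊥ = ker (m†)` of a `†`-subobject. -/
noncomputable def perp {X : H} (S : ClSub X) : ClSub X :=
  ClSub.mk (ker (dagger S.incl)) (ker_isDaggerMono _)

theorem perp_antitone {X : H} {S T : ClSub X} (h : S ≤ T) : perp T ≤ perp S := by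
  obtain ⟨i, hi⟩ := (ClSub.le_iff S T).1 h
  refine (ClSub.mk_le_mk _ _).2 (ker_lift _ _ ?_)
  rw [← hi, dagger_comp, ← Category.assoc, ker_comp, zero_comp]

/-- The orthocomplement does not depend on the representative. -/
theorem perp_mk {X M : H} (m : M ⟶ X) (hm : IsDaggerMono m) :
    perp (ClSub.mk m hm) = ClSub.mk (ker (dagger m)) (ker_isDaggerMono _) := by
  have h := ClSub.mk_incl (ClSub.mk m hm)
  obtain ⟨i, hi⟩ := (ClSub.mk_le_mk _ _).1 h.le
  obtain ⟨j, hj⟩ := (ClSub.mk_le_mk _ _).1 h.ge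
  apply le_antisymm
  · refine (ClSub.mk_le_mk _ _).2 (ker_lift _ _ ?_)
    have hd := (congrArg dagger hj).symm
    rw [dagger_comp] at hd
    rw [hd, ← Category.assoc, ker_comp, zero_comp]
  · refine (ClSub.mk_le_mk _ _).2 (ker_lift _ _ ?_)
    rw [← hi, dagger_comp, ← Category.assoc, ker_comp, zero_comp]

/-- The functor `⊥ : ClSub(X)ᵒᵖ ⥤ ClSub(X)`. -/
noncomputable def perpFunctor (X : H) : (ClSub X)ᵒᵖ ⥤ ClSub X where
  obj S := perp S.unop
  map i := homOfLE (perp_antitone (leOfHom i.unop))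

/-- The existential quantifier `∃_f (n) = Im (f ∘ n)`. -/
noncomputable def exist {X Y : H} (f : X ⟶ Y) (S : ClSub X) : ClSub Y :=
  ClSub.mk (im (S.incl ≫ f)) (im_isDaggerMono _)

/-- The existential quantifier depends neither on the representative nor on the factorisation. -/
theorem exist_mk {X Y M I : H} (f : X ⟶ Y) (m : M ⟶ X) (hm : IsDaggerMono m) (e : M ⟶ I)
    (n : I ⟶ Y) (he : Epi e) (hn : IsDaggerMono n) (h : e ≫ n = m ≫ f) :
    exist f (ClSub.mk m hm) = ClSub.mk n hn := by
  have hS := ClSub.mk_incl (ClSub.mk m hm)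
  obtain ⟨i, hi⟩ := (ClSub.mk_le_mk _ _).1 hS.le
  obtain ⟨j, hj⟩ := (ClSub.mk_le_mk _ _).1 hS.ge
  apply le_antisymm
  · refine (ClSub.mk_le_mk _ _).2 (factorisation_le (a := i ≫ e) (coim_epi _) hn ?_)
    rw [coim_im, Category.assoc, h, ← Category.assoc, hi]
  · refine (ClSub.mk_le_mk _ _).2 (factorisation_le
      (a := j ≫ coim ((ClSub.mk m hm).incl ≫ f)) he (im_isDaggerMono _) ?_)
    rw [h, Category.assoc, coim_im, ← Category.assoc, hj]

theorem exist_mono {X Y : H} (f : X ⟶ Y) : Monotone (exist f) := by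
  intro S T h
  obtain ⟨i, hi⟩ := (ClSub.le_iff S T).1 h
  refine (ClSub.mk_le_mk _ _).2 (factorisation_le (a := i ≫ coim (T.incl ≫ f))
    (coim_epi (S.incl ≫ f)) (im_isDaggerMono _) ?_)
  rw [coim_im, Category.assoc, coim_im, ← Category.assoc, hi]

/-- The functor `∃_f : ClSub(X) ⥤ ClSub(Y)`. -/
noncomputable def existFunctor {X Y : H} (f : X ⟶ Y) : ClSub X ⥤ ClSub Y :=
  (exist_mono f).functor

/-- The functor `f^⊥ = ⊥_Y ∘ (∃_f)ᵒᵖ : ClSub(X)ᵒᵖ ⥤ ClSub(Y)`. -/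
noncomputable def morPerp {X Y : H} (f : X ⟶ Y) : (ClSub X)ᵒᵖ ⥤ ClSub Y :=
  (existFunctor f).op ⋙ perpFunctor Y

/-- An object `X` is simple when `Sub(X) = {0, X}`. -/
def IsSimpleObj (X : H) : Prop :=
  ∀ S : Subobject X, S = ⊥ ∨ S = ⊤

end PreHilbert

/-- Multiplication of a morphism `f` by a scalar `s : C ⟶ C`, where `C` is the monoidal unit:
`X ≅ C ⊗ X ⟶ C ⊗ Y ≅ Y`. -/
def scalarMul {H : Type u} [Category.{v} H] [MonoidalCategory H] {X Y : H}
    (s : 𝟙_ H ⟶ 𝟙_ H) (f : X ⟶ Y) : X ⟶ Y :=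
  (λ_ X).inv ≫ (s ⊗ₘ f) ≫ (λ_ Y).hom

end PreHilb

namespace PreHilb

open DaggerCategory PreHilbertCategory

section Scalars

variable {H : Type u} [Category.{v} H] [MonoidalCategory H]

/-! Call `y† f x`, for points `x : C → X` and `y : C → Y`, a matrix coefficient of `f`. As `C`
generates and the dagger makes it a cogenerator, coefficients determine a morphism. The adjunction,
read on images of points, says that `f` and `k = g†` have the same vanishing coefficients
(`orthogonal_iff_of_adjunction`).

For fixed `y`, the functional `y† k` vanishes on the points where `y† f` does. Since `C` is simple,
`y† f` is essentially the cokernel of its kernel, so `y† k = t_y y† f`; dually `k x = f x r_x`. A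
nonzero coefficient is invertible by Schur's lemma and scalars commute, so `r_x = t_y` whenever `y†
f x ≠ 0`. Any two relevant `y` share an `x` of this kind, possibly a sum of two points, so `t_y` is
constant (`exists_scalar_of_coefficients`). Uniqueness follows by cancelling an invertible
coefficient. -/

theorem comp_scalarMul {W X Y : H} (s : 𝟙_ H ⟶ 𝟙_ H) (x : W ⟶ X) (f : X ⟶ Y) :
    x ≫ scalarMul s f = scalarMul s (x ≫ f) := by
  simp [scalarMul, MonoidalCategory.tensorHom_def']

theorem scalarMul_unit {X : H} (s : 𝟙_ H ⟶ 𝟙_ H) (x : 𝟙_ H ⟶ X) :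
    scalarMul s x = s ≫ x := by
  simp [scalarMul, MonoidalCategory.tensorHom_def, unitors_equal, unitors_inv_equal]

theorem point_comp_scalarMul {X Y : H} (s : 𝟙_ H ⟶ 𝟙_ H) (x : 𝟙_ H ⟶ X) (f : X ⟶ Y) :
    x ≫ scalarMul s f = s ≫ x ≫ f := by
  rw [comp_scalarMul, scalarMul_unit]

/-- Evaluate both sides of `t ≫ (s • 𝟙) = s • t` on the unit, where scaling is precomposition. -/
theorem scalar_comm (s t : 𝟙_ H ⟶ 𝟙_ H) : s ≫ t = t ≫ s := by
  have h := comp_scalarMul s t (𝟙 _)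
  rw [scalarMul_unit, scalarMul_unit, Category.comp_id, Category.comp_id] at h
  exact h.symm

end Scalars

section DaggerBasic

variable {H : Type u} [Category.{v} H] [DaggerCategory H]

theorem dagger_injective {X Y : H} {f g : X ⟶ Y} (h : dagger f = dagger g) : f = g := by
  rw [← dagger_dagger f, h, dagger_dagger]

theorem mono_dagger {X Y : H} {e : X ⟶ Y} (he : Epi e) : Mono (dagger e) :=
  ⟨fun a b w => dagger_injective <| by
    rw [← cancel_epi e]
    simpa [dagger_comp, dagger_dagger] using congrArg dagger w⟩

theorem mono_of_epi_dagger {X Y : H} {m : X ⟶ Y} (hm : Epi (dagger m)) : Mono m := by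
  simpa [dagger_dagger] using mono_dagger hm

/-- Two morphisms with the same matrix coefficients are equal. -/
theorem ext_of_coefficients [MonoidalCategory H] (hgen : IsSeparator (𝟙_ H)) {X Y : H}
    {f k : X ⟶ Y}
    (h : ∀ (x : 𝟙_ H ⟶ X) (y : 𝟙_ H ⟶ Y), x ≫ f ≫ dagger y = x ≫ k ≫ dagger y) : f = k := by
  -- The generator is used twice: on `X`, then after a dagger on `Y`.
  refine (isSeparator_def _).1 hgen _ _ fun x => dagger_injective <|
    (isSeparator_def _).1 hgen _ _ fun y => dagger_injective ?_
  simpa [dagger_comp, dagger_dagger] using h x y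

end DaggerBasic

variable {H : Type u} [Category.{v} H] [HasZeroMorphisms H] [DaggerCategory H]
  [MonoidalCategory H] [SymmetricCategory H] [PreHilbertCategory H]

theorem dagger_eq_zero_iff {X Y : H} (f : X ⟶ Y) : dagger f = 0 ↔ f = 0 := by
  constructor
  · intro h
    exact dagger_injective (h.trans (dagger_zero X Y).symm)
  · rintro rfl
    exact dagger_zero X Y

/-! ### Simple objects and Schur's lemma -/

theorem isIso_of_mono_of_isSimpleObj {X Z : H} (hX : IsSimpleObj X) (m : Z ⟶ X) [Mono m]
    (hm : m ≠ 0) : IsIso m := by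
  rcases hX (Subobject.mk m) with h | h
  · exact absurd (Subobject.mk_eq_bot_iff_zero.1 h) hm
  · exact (Subobject.isIso_iff_mk_eq_top m).2 h

theorem epi_of_isSimpleObj {X Z : H} (hX : IsSimpleObj X) (f : Z ⟶ X) (hf : f ≠ 0) : Epi f := by
  have := coim_epi f
  have := (im_isDaggerMono f).mono
  have : IsIso (im f) := isIso_of_mono_of_isSimpleObj hX _ fun h => hf <| by
    rw [← coim_im f, h, comp_zero]
  rw [← coim_im f]
  infer_instance

/-- Schur's lemma for a simple object. -/
theorem isIso_of_isSimpleObj {X : H} (hX : IsSimpleObj X) (s : X ⟶ X) (hs : s ≠ 0) : IsIso s := by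
  -- The dagger of `s` is nonzero, hence epi, and the dagger exchanges epis and monos.
  have : Mono s := mono_of_epi_dagger <| epi_of_isSimpleObj hX _ <| (dagger_eq_zero_iff s).not.2 hs
  exact isIso_of_mono_of_isSimpleObj hX s hs

/-- A morphism to a simple object is, up to an isomorphism, the cokernel of its kernel. -/
theorem exists_comp_eq_of_ker_comp_eq_zero {X Z W : H} (hZ : IsSimpleObj Z) (φ : X ⟶ Z)
    (hφ : φ ≠ 0) (ψ : X ⟶ W) (h : ker φ ≫ ψ = 0) : ∃ t : Z ⟶ W, ψ = φ ≫ t := by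
  -- The dagger of the factorisation of `φ†` writes `φ` as a `†`-epi followed by a mono into `Z`,
  -- which is invertible because `Z` is simple.
  have hfac := congrArg dagger (coim_im (dagger φ))
  rw [dagger_comp, dagger_dagger] at hfac
  have := mono_dagger (coim_epi (dagger φ))
  have : IsIso (dagger (coim (dagger φ))) := isIso_of_mono_of_isSimpleObj hZ _ fun h => hφ <| by
    rw [← hfac, h, comp_zero]
  -- `c†` lands in the kernel of `φ`, so `ψ` kills it. Dually `c` kills `ψ†`, which therefore
  -- factors through `im φ†`, the kernel of `c`.
  obtain ⟨V, c, w, ⟨hk⟩⟩ := isKernel_of_isDaggerMono _ (im_isDaggerMono (dagger φ))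
  obtain ⟨l, hl⟩ := ker_lift φ (dagger c) <| by
    rw [← hfac, ← Category.assoc, ← dagger_comp, w, dagger_zero, zero_comp]
  obtain ⟨r, hr⟩ := KernelFork.IsLimit.lift' hk (dagger ψ) <| dagger_injective <| by
    rw [dagger_comp, dagger_dagger, ← hl, Category.assoc, h, comp_zero, dagger_zero]
  have hr' := congrArg dagger hr
  rw [dagger_dagger, Fork.ι_ofι, dagger_comp] at hr'
  refine ⟨inv (dagger (coim (dagger φ))) ≫ dagger r, ?_⟩
  rw [← hr', ← Category.assoc]
  congr 1
  rw [IsIso.eq_comp_inv, hfac]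

/-- A sum `x` of `x₁` and `x₂`: a morphism killing one summand cannot tell `x` from the other. -/
theorem exists_point_add {X P : H} (x₁ x₂ : P ⟶ X) :
    ∃ x : P ⟶ X, ∀ {Z : H} (φ : X ⟶ Z), (x₂ ≫ φ = 0 → x ≫ φ = x₁ ≫ φ) ∧
      (x₁ ≫ φ = 0 → x ≫ φ = x₂ ≫ φ) := by
  obtain ⟨b, ⟨hb⟩, -⟩ := exists_daggerBiproduct P P
  let d : b.pt ⟶ X := BinaryCofan.IsColimit.desc hb.isColimit x₁ x₂
  let δ : P ⟶ b.pt := BinaryFan.IsLimit.lift hb.isLimit (𝟙 P) (𝟙 P)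
  have hl : b.inl ≫ d = x₁ := BinaryCofan.IsColimit.inl_desc hb.isColimit x₁ x₂
  have hr : b.inr ≫ d = x₂ := BinaryCofan.IsColimit.inr_desc hb.isColimit x₁ x₂
  have h1 : δ ≫ b.fst = 𝟙 P := BinaryFan.IsLimit.lift_fst hb.isLimit (𝟙 P) (𝟙 P)
  have h2 : δ ≫ b.snd = 𝟙 P := BinaryFan.IsLimit.lift_snd hb.isLimit (𝟙 P) (𝟙 P)
  -- Diagonal followed by copairing. If `φ` kills one summand, `d ≫ φ` factors through the
  -- projection to the other.
  refine ⟨δ ≫ d, fun φ => ⟨fun h => ?_, fun h => ?_⟩⟩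
  · have : d ≫ φ = b.fst ≫ x₁ ≫ φ := BinaryCofan.IsColimit.hom_ext hb.isColimit
      (by simp [← hl]) (by simp [← Category.assoc _ d, hr, h])
    rw [Category.assoc, this, ← Category.assoc, h1, Category.id_comp]
  · have : d ≫ φ = b.snd ≫ x₂ ≫ φ := BinaryCofan.IsColimit.hom_ext hb.isColimit
      (by simp [← Category.assoc _ d, hl, h]) (by simp [← hr])
    rw [Category.assoc, this, ← Category.assoc, h2, Category.id_comp]

/-! ### Orthogonality and the adjunction -/

theorem mk_le_perp_mk {X M N : H} {m : M ⟶ X} {n : N ⟶ X} (hm : IsDaggerMono m)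
    (hn : IsDaggerMono n) : ClSub.mk n hn ≤ perp (ClSub.mk m hm) ↔ n ≫ dagger m = 0 := by
  rw [perp_mk, ClSub.mk_le_mk]
  constructor
  · rintro ⟨i, rfl⟩
    rw [Category.assoc, ker_comp, comp_zero]
  · exact ker_lift _ _

/-- The image of `y` is orthogonal to the direct image under `f` of the image of `x` if and only
if `y` is orthogonal to `f x`. -/
theorem mk_im_le_perp_exist {X Y P Q : H} (f : X ⟶ Y) (x : P ⟶ X) (y : Q ⟶ Y) :
    ClSub.mk (im y) (im_isDaggerMono y) ≤ perp (exist f (ClSub.mk (im x) (im_isDaggerMono x))) ↔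
      y ≫ dagger (x ≫ f) = 0 := by
  -- The epi parts of the factorisations, or their monic daggers, can be cancelled, so images may be
  -- replaced by the morphisms themselves.
  have := coim_epi y
  have := mono_dagger (coim_epi x)
  have := mono_dagger (coim_epi (im x ≫ f))
  rw [exist_mk f (im x) (im_isDaggerMono x) _ _ (coim_epi (im x ≫ f)) (im_isDaggerMono _)
    (coim_im _), mk_le_perp_mk, ← cancel_mono (dagger (coim (im x ≫ f))), zero_comp,
    Category.assoc, ← dagger_comp, coim_im, ← cancel_mono (dagger (coim x)), zero_comp,
    Category.assoc, ← dagger_comp, ← Category.assoc, coim_im, ← cancel_epi (coim y), comp_zero,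
    ← Category.assoc, coim_im]

/-- The adjunction `f^⊥ ⊣ g^⊥` says that `f x ⊥ y` if and only if `x ⊥ g y`. -/
theorem orthogonal_iff_of_adjunction {X Y P Q : H} {f : X ⟶ Y} {g : Y ⟶ X}
    (adj : (morPerp f).rightOp ⊣ morPerp g) (x : P ⟶ X) (y : Q ⟶ Y) :
    x ≫ f ≫ dagger y = 0 ↔ x ≫ dagger g ≫ dagger y = 0 := by
  let S := ClSub.mk (im x) (im_isDaggerMono x)
  let T := ClSub.mk (im y) (im_isDaggerMono y)
  -- In posets the adjunction is a Galois connection; the opposite on `ClSub Y` reverses the left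
  -- inequality.
  have key : T ≤ perp (exist f S) ↔ S ≤ perp (exist g T) :=
    ⟨fun h => leOfHom (adj.homEquiv S (Opposite.op T) (homOfLE h).op),
      fun h => leOfHom ((adj.homEquiv S (Opposite.op T)).symm (homOfLE h)).unop⟩
  rw [mk_im_le_perp_exist, mk_im_le_perp_exist] at key
  rw [← dagger_comp, ← key, ← dagger_eq_zero_iff (y ≫ _), dagger_comp, dagger_dagger,
    Category.assoc]

/-! ### Proportionality of matrix coefficients -/

/-- Over a simple generator, a functional vanishing wherever `φ` does is a multiple of `φ`. -/
theorem exists_eq_comp_scalar (hsimple : IsSimpleObj (𝟙_ H)) (hgen : IsSeparator (𝟙_ H))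
    {X : H} (φ ψ : X ⟶ 𝟙_ H) (h : ∀ x : 𝟙_ H ⟶ X, x ≫ φ = 0 → x ≫ ψ = 0) :
    ∃ t : 𝟙_ H ⟶ 𝟙_ H, ψ = φ ≫ t := by
  by_cases hφ : φ = 0
  · refine ⟨0, (isSeparator_def _).1 hgen _ _ fun x => ?_⟩
    rw [h x (by rw [hφ, comp_zero]), comp_zero, comp_zero]
  · refine exists_comp_eq_of_ker_comp_eq_zero hsimple φ hφ ψ <|
      (isSeparator_def _).1 hgen _ _ fun a => ?_
    rw [comp_zero, ← Category.assoc, h _ (by rw [Category.assoc, ker_comp, comp_zero])]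

/-- If all matrix coefficients of `k` vanish where those of `f` do, they are proportional. -/
theorem exists_scalar_of_coefficients (hsimple : IsSimpleObj (𝟙_ H)) (hgen : IsSeparator (𝟙_ H))
    {X Y : H} (f k : X ⟶ Y)
    (h : ∀ (x : 𝟙_ H ⟶ X) (y : 𝟙_ H ⟶ Y), x ≫ f ≫ dagger y = 0 → x ≫ k ≫ dagger y = 0) :
    ∃ s : 𝟙_ H ⟶ 𝟙_ H, ∀ (x : 𝟙_ H ⟶ X) (y : 𝟙_ H ⟶ Y),
      x ≫ k ≫ dagger y = (x ≫ f ≫ dagger y) ≫ s := by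
  by_cases hf : ∀ (x : 𝟙_ H ⟶ X) (y : 𝟙_ H ⟶ Y), x ≫ f ≫ dagger y = 0
  · exact ⟨0, fun x y => by rw [comp_zero, h x y (hf x y)]⟩
  push Not at hf
  obtain ⟨x₀, y₀, h₀⟩ := hf
  have col (y : 𝟙_ H ⟶ Y) : ∃ t : 𝟙_ H ⟶ 𝟙_ H, k ≫ dagger y = (f ≫ dagger y) ≫ t :=
    exists_eq_comp_scalar hsimple hgen _ _ fun x => h x y
  -- Daggers turn rows into columns.
  have row (x : 𝟙_ H ⟶ X) : ∃ r : 𝟙_ H ⟶ 𝟙_ H, x ≫ k = r ≫ x ≫ f := by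
    obtain ⟨t, ht⟩ := exists_eq_comp_scalar hsimple hgen (dagger (x ≫ f)) (dagger (x ≫ k))
      fun y hy => by
        rw [← dagger_eq_zero_iff, dagger_comp, dagger_dagger, Category.assoc] at hy ⊢
        exact h x y hy
    refine ⟨dagger t, dagger_injective ?_⟩
    rw [ht, dagger_comp (dagger t), dagger_dagger]
  choose t ht using col
  choose r hr using row
  -- The coefficient of `k` at `x, y` is computed through the row and through the column.
  have hrt (x : 𝟙_ H ⟶ X) (y : 𝟙_ H ⟶ Y) (hxy : x ≫ f ≫ dagger y ≠ 0) : r x = t y := by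
    have := isIso_of_isSimpleObj hsimple _ hxy
    rw [← cancel_mono (x ≫ f ≫ dagger y), scalar_comm (t y), Category.assoc, Category.assoc,
      ← Category.assoc f, ← ht, ← Category.assoc x k, hr, Category.assoc, Category.assoc]
  refine ⟨t y₀, fun x y => ?_⟩
  by_cases hxy : x ≫ f ≫ dagger y = 0
  · rw [h x y hxy, hxy, zero_comp]
  have hty : t y = t y₀ := by
    obtain ⟨z, hz⟩ : ∃ z : 𝟙_ H ⟶ X, z ≫ f ≫ dagger y ≠ 0 ∧ z ≫ f ≫ dagger y₀ ≠ 0 := by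
      by_cases h₁ : x ≫ f ≫ dagger y₀ = 0
      · by_cases h₂ : x₀ ≫ f ≫ dagger y = 0
        -- Here `x` is detected only by `y` and `x₀` only by `y₀`, so their sum is detected by both.
        · obtain ⟨z, hz⟩ := exists_point_add x x₀
          exact ⟨z, by rwa [(hz _).1 h₂], by rwa [(hz _).2 h₁]⟩
        · exact ⟨x₀, h₂, h₀⟩
      · exact ⟨x, hxy, h₁⟩
    rw [← hrt z y hz.1, hrt z y₀ hz.2]
  rw [ht, hty, Category.assoc, Category.assoc, Category.assoc]

end PreHilb

theorem mainTheorem6 {H : Type u} [Category.{v} H] [HasZeroMorphisms H] [DaggerCategory H]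
    [MonoidalCategory H] [SymmetricCategory H] [PreHilbertCategory H]
    (hsimple : PreHilb.IsSimpleObj (𝟙_ H)) (hgen : IsSeparator (𝟙_ H))
    {X Y : H} (f : X ⟶ Y) (g : Y ⟶ X)
    (adj : (PreHilb.morPerp f).rightOp ⊣ PreHilb.morPerp g) :
    (∃ s : 𝟙_ H ⟶ 𝟙_ H, g = PreHilb.scalarMul s (DaggerCategory.dagger f)) ∧
      (f ≠ 0 → ∃! s : 𝟙_ H ⟶ 𝟙_ H, g = PreHilb.scalarMul s (DaggerCategory.dagger f)) := by
  have coeff (s : 𝟙_ H ⟶ 𝟙_ H) (x : 𝟙_ H ⟶ X) (y : 𝟙_ H ⟶ Y) :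
      y ≫ PreHilb.scalarMul s (DaggerCategory.dagger f) ≫ DaggerCategory.dagger x =
        s ≫ DaggerCategory.dagger (x ≫ f ≫ DaggerCategory.dagger y) := by
    rw [← Category.assoc, PreHilb.point_comp_scalarMul]
    simp [DaggerCategory.dagger_comp, DaggerCategory.dagger_dagger]
  have hex : ∃ s : 𝟙_ H ⟶ 𝟙_ H, g = PreHilb.scalarMul s (DaggerCategory.dagger f) := by
    obtain ⟨s, hs⟩ := PreHilb.exists_scalar_of_coefficients hsimple hgen f
      (DaggerCategory.dagger g) fun x y => (PreHilb.orthogonal_iff_of_adjunction adj x y).1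
    -- `s` relates `g†` to `f`; passing to `g` and `f†` conjugates it.
    refine ⟨DaggerCategory.dagger s, PreHilb.ext_of_coefficients hgen fun y x => ?_⟩
    rw [coeff, ← DaggerCategory.dagger_comp, ← hs]
    simp [DaggerCategory.dagger_comp, DaggerCategory.dagger_dagger]
  refine ⟨hex, fun hf => ?_⟩
  obtain ⟨s, hs⟩ := hex
  refine ⟨s, hs, fun s' hs' => ?_⟩
  -- A nonzero `f` has a nonzero coefficient; its dagger is invertible and cancels from `coeff`.
  obtain ⟨x, y, hxy⟩ : ∃ (x : 𝟙_ H ⟶ X) (y : 𝟙_ H ⟶ Y),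
      x ≫ f ≫ DaggerCategory.dagger y ≠ 0 := by
    by_contra! hzero
    exact hf (PreHilb.ext_of_coefficients hgen fun x y => by
      rw [hzero x y, zero_comp, comp_zero])
  have := PreHilb.isIso_of_isSimpleObj hsimple _ ((PreHilb.dagger_eq_zero_iff _).not.2 hxy)
  rw [← cancel_mono (DaggerCategory.dagger (x ≫ f ≫ DaggerCategory.dagger y)), ← coeff, ← coeff,
    ← hs, ← hs']
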